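/- Let $0<\tau<1$. Let $H_n$ be the (physicists') Hermite polynomials, $H_n(x)=(-1)^n e^{x^2}\frac{d^n}{dx^n}e^{-x^2}$, put $\operatorname{erfc}(x)=\frac{2}{\sqrt\pi}\int_x^\infty e^{-t^2}\,dt$, and define $$C_n(z)=\Big(\frac{\tau}{2}\Big)^{n/2}H_n\Big(\frac{z}{\sqrt{2\tau}}\Big)\quad(n\ge 0),\qquad R_{2n}(z)=C_{2n}(z),\qquad R_{2n+1}(z)=C_{2n+1}(z)-2n\,C_{2n-1}(z)\quad(n\ge 0),$$ where for $n=0$ the last term is absent, i.e. $R_1=C_1$. For polynomials $f,g\in\mathbb C[z]$ let $\langle f,g\rangle=\langle f,g\rangle_{\rm r}+\langle f,g\rangle_{\rm c}$ with $$\langle f,g\rangle_{\rm r}=\int_{-\infty}^{\infty}dx\int_{-\infty}^{\infty}dy\;e^{-\frac{x^2+y^2}{2(1+\tau)}}f(x)\,g(y)\,\operatorname{sgn}(y-x),$$ $$\langle f,g\rangle_{\rm c}=2i\int_{-\infty}^{\infty}dx\int_0^{\infty}dy\;e^{\frac{y^2-x^2}{1+\tau}}\operatorname{erfc}\Big(\sqrt{\tfrac{2}{1-\tau^2}}\;y\Big)\big[f(x+iy)\,g(x-iy)-g(x+iy)\,f(x-iy)\big].$$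 Then these integrals converge absolutely for all polynomials $f,g$. The polynomials $C_n$ and $R_n$ are monic of degree $n$ for every $n\ge0$. The family $(R_j)_{j\ge0}$ is skew orthogonal with respect to $\langle\cdot,\cdot\rangle$, that is, $$\langle R_{2j},R_{2k}\rangle=\langle R_{2j+1},R_{2k+1}\rangle=0\quad(j,k\ge0),\qquad \langle R_{2j},R_{2k+1}\rangle=0\quad(j,k\ge 0,\ j\ne k),$$ while $\langle R_{2j},R_{2j+1}\rangle\ne0$ for all $j\ge 0$. Moreover, for every $n\ge0$, $$r_n:=\langle R_{2n},R_{2n+1}\rangle=(2n)!\;2\sqrt{2\pi}\,(1+\tau).$$ -/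

import Mathlib

open Polynomial

/-- The complementary error function `erfc x = (2 / √π) ∫_x^∞ e^{-t²} dt`. -/
noncomputable def erfc (x : ℝ) : ℝ :=
  2 / Real.sqrt Real.pi * ∫ t in Set.Ioi x, Real.exp (-t ^ 2)

/-- The (physicists') Hermite polynomials `H_n`, with leading coefficient `2 ^ n`:
`H_0 = 1` and `H_{n+1} = 2 X H_n - H_n'`, which is the recursion equivalent to
`H_n(x) = (-1)^n e^{x²} (d/dx)^n e^{-x²}`. -/
noncomputable def physHermite : ℕ → ℂ[X]
  | 0 => 1
  | n + 1 => 2 * X * physHermite n - derivative (physHermite n)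

/-- The scaled Hermite polynomials `C_n(z) = (τ/2)^{n/2} H_n(z / √(2τ))`. -/
noncomputable def scaledHermite (τ : ℝ) (n : ℕ) : ℂ[X] :=
  C (((τ / 2) ^ ((n : ℝ) / 2) : ℝ) : ℂ) *
    (physHermite n).comp (C (((Real.sqrt (2 * τ))⁻¹ : ℝ) : ℂ) * X)

theorem scaledHermite_eval (τ : ℝ) (n : ℕ) (z : ℂ) :
    (scaledHermite τ n).eval z =
      (((τ / 2) ^ ((n : ℝ) / 2) : ℝ) : ℂ) *
        (physHermite n).eval (z / ((Real.sqrt (2 * τ) : ℝ) : ℂ)) := by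
  simp only [scaledHermite, eval_mul, eval_C, eval_comp, eval_X, Complex.ofReal_inv]
  rw [div_eq_inv_mul z]

/-- The polynomials `R_{2n} = C_{2n}` and `R_{2n+1} = C_{2n+1} - 2n C_{2n-1}`
(for `n = 0` the second term has coefficient `0`, so `R_1 = C_1`). -/
noncomputable def skewPoly (τ : ℝ) (j : ℕ) : ℂ[X] :=
  if Even j then scaledHermite τ j
  else scaledHermite τ j - C ((j - 1 : ℕ) : ℂ) * scaledHermite τ (j - 2)

theorem skewPoly_even (τ : ℝ) (n : ℕ) :
    skewPoly τ (2 * n) = scaledHermite τ (2 * n) := by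
  simp [skewPoly]

theorem skewPoly_one (τ : ℝ) : skewPoly τ 1 = scaledHermite τ 1 := by
  simp [skewPoly]

theorem skewPoly_odd (τ : ℝ) (n : ℕ) :
    skewPoly τ (2 * n + 1) =
      scaledHermite τ (2 * n + 1) - C (2 * n : ℂ) * scaledHermite τ (2 * n - 1) := by
  have h : ¬ Even (2 * n + 1) := by simp
  have h2 : 2 * n + 1 - 2 = 2 * n - 1 := by omega
  rw [skewPoly, if_neg h, h2]
  simp

/-- The integrand `e^{-(x²+y²)/(2(1+τ))} f(x) g(y) sgn(y - x)` of the real part. -/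
noncomputable def realIntegrand (τ : ℝ) (f g : ℂ[X]) (x y : ℝ) : ℂ :=
  (Real.exp (-(x ^ 2 + y ^ 2) / (2 * (1 + τ))) : ℂ) *
    f.eval (x : ℂ) * g.eval (y : ℂ) * (Real.sign (y - x) : ℂ)

/-- The integrand
`e^{(y²-x²)/(1+τ)} erfc(√(2/(1-τ²)) y) (f(x+iy) g(x-iy) - g(x+iy) f(x-iy))`
of the complex part. -/
noncomputable def complexIntegrand (τ : ℝ) (f g : ℂ[X]) (x y : ℝ) : ℂ :=
  (Real.exp ((y ^ 2 - x ^ 2) / (1 + τ)) : ℂ) *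
    (erfc (Real.sqrt (2 / (1 - τ ^ 2)) * y) : ℂ) *
    (f.eval ((x : ℂ) + Complex.I * y) * g.eval ((x : ℂ) - Complex.I * y) -
      g.eval ((x : ℂ) + Complex.I * y) * f.eval ((x : ℂ) - Complex.I * y))

/-- The real part `⟨f, g⟩_r` of the skew inner product. -/
noncomputable def skewInnerReal (τ : ℝ) (f g : ℂ[X]) : ℂ :=
  ∫ x : ℝ, ∫ y : ℝ, realIntegrand τ f g x y

/-- The complex part `⟨f, g⟩_c` of the skew inner product. -/
noncomputable def skewInnerComplex (τ : ℝ) (f g : ℂ[X]) : ℂ :=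
  2 * Complex.I * ∫ x : ℝ, ∫ y in Set.Ioi (0 : ℝ), complexIntegrand τ f g x y

/-- The skew inner product `⟨f, g⟩ = ⟨f, g⟩_r + ⟨f, g⟩_c`. -/
noncomputable def skewInner (τ : ℝ) (f g : ℂ[X]) : ℂ :=
  skewInnerReal τ f g + skewInnerComplex τ f g

/-- The family `p_0, p_1, …` is skew orthogonal with respect to `B`. -/
def IsSkewOrthogonal (B : ℂ[X] → ℂ[X] → ℂ) (p : ℕ → ℂ[X]) : Prop :=
  (∀ j k : ℕ, B (p (2 * j)) (p (2 * k)) = 0) ∧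
  (∀ j k : ℕ, B (p (2 * j + 1)) (p (2 * k + 1)) = 0) ∧
  (∀ j k : ℕ, j ≠ k → B (p (2 * j)) (p (2 * k + 1)) = 0) ∧
  (∀ j : ℕ, B (p (2 * j)) (p (2 * j + 1)) ≠ 0)

/-! Let `D f = f' - z f / (1 + τ)`, the derivative conjugated by `e^{-z²/(2(1+τ))}`. Everything
rests on `skewInner_weightedDerivative`: pairing `D f` with `g` in the skew product equals, up to
the constant `erfcSlope τ`, the bilinear planar pairing of `f(z)` and `g(z̄)` with weight
`e^{-x²/(1+τ) - y²/(1-τ)}`. To see this, integrate by parts. In the real part, differentiating the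
sign function leaves twice a line integral of `f g e^{-x²/(1+τ)}`. In the complex part, the boundary
`y = 0` gives the negative of the same integral, and differentiating `erfc` turns its weight into
the Gaussian one. The line integrals cancel. The `C_n` are orthogonal for the planar pairing,
because `f ↦ z f - τ f'`, which raises `C_n` to `C_{n+1}`, is adjoint to differentiation, and
`C_{n+1}' = (n+1) C_n`. Since `R_{2k+1} = -(1+τ) D C_{2k}`, all even-odd products follow by
antisymmetry. Products of equal parity vanish because `z ↦ -z` reverses the sign of the form. -/

/-! ### Recurrences, degrees and parity of the polynomials -/

theorem derivative_physHermite_succ (n : ℕ) :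
    derivative (physHermite (n + 1)) = C (2 * (n + 1 : ℂ)) * physHermite n := by
  induction n with
  | zero => simp [physHermite, map_ofNat]
  | succ n ih =>
    have h1 : physHermite (n + 1 + 1)
      = 2 * X * physHermite (n + 1) - derivative (physHermite (n + 1)) := rfl
    have h2 : physHermite (n + 1) = 2 * X * physHermite n - derivative (physHermite n) := rfl
    have h3 : derivative (derivative (physHermite (n + 1)))
      = C (2 * (n + 1 : ℂ)) * derivative (physHermite n) := by
      rw [ih, derivative_C_mul]
    rw [h1, derivative_sub, derivative_mul, h3, ih]
    simp only [derivative_mul, derivative_X, derivative_ofNat]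
    push_cast
    rw [h2]
    simp only [map_mul, map_add, map_ofNat, map_one, map_natCast]
    ring

theorem physHermite_comp_neg_X (n : ℕ) :
    (physHermite n).comp (-X) = (-1) ^ n * physHermite n := by
  induction n with
  | zero => simp [physHermite]
  | succ n ih =>
    have h2 : physHermite (n + 1) = 2 * X * physHermite n - derivative (physHermite n) := rfl
    have h3 : (derivative (physHermite n)).comp (-X)
        = -((-1) ^ n * derivative (physHermite n)) := by
      have := congrArg derivative ih
      rw [derivative_comp] at this
      have h4 : derivative ((-1 : ℂ[X]) ^ n * physHermite n)
          = (-1) ^ n * derivative (physHermite n) := by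
        have : (-1 : ℂ[X]) ^ n = C ((-1) ^ n) := by simp
        rw [this, derivative_C_mul]
      rw [h4] at this
      rw [← this]
      simp
    rw [h2, sub_comp, h3, mul_comp, mul_comp, ih]
    simp
    ring

section
variable {τ : ℝ}

/-- The factor `√(τ/2)` gained with each degree cancels the `2 / √(2τ)` coming from `2X` after
rescaling; this is what makes the `C_n` monic. -/
theorem mul_inv_sqrt_two_mul (hτ : 0 < τ) :
    τ * (Real.sqrt (2 * τ))⁻¹ * (2 * (Real.sqrt (2 * τ))⁻¹) = 1 := by
  have h : (Real.sqrt (2 * τ))⁻¹ * (Real.sqrt (2 * τ))⁻¹ = (2 * τ)⁻¹ := by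
    rw [← mul_inv, Real.mul_self_sqrt (by positivity)]
  have h' : 2 * τ * (2 * τ)⁻¹ = 1 := mul_inv_cancel₀ (by positivity)
  linear_combination 2 * τ * h + h'

theorem scaledHermite_zero : scaledHermite τ 0 = 1 := by
  simp [scaledHermite, physHermite]

theorem derivative_scaledHermite (n : ℕ) : derivative (scaledHermite τ n) =
    C ((((τ / 2) ^ ((n : ℝ) / 2) : ℝ) : ℂ) * (((Real.sqrt (2 * τ))⁻¹ : ℝ) : ℂ)) *
      (derivative (physHermite n)).comp (C (((Real.sqrt (2 * τ))⁻¹ : ℝ) : ℂ) * X) := by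
  rw [scaledHermite, derivative_C_mul, derivative_comp]
  simp only [derivative_mul, derivative_C, derivative_X, zero_mul, zero_add, mul_one, C_mul]
  ring

theorem rpow_half_succ (hτ : 0 < τ) (n : ℕ) :
    (τ / 2) ^ (((n + 1 : ℕ) : ℝ) / 2) = (τ / 2) ^ ((n : ℝ) / 2) * (τ * (Real.sqrt (2 * τ))⁻¹) := by
  have h : τ * (Real.sqrt (2 * τ))⁻¹ = (τ / 2) ^ ((1 : ℝ) / 2) := by
    rw [← Real.sqrt_eq_rpow, ← div_eq_mul_inv, div_eq_iff (by positivity),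
      ← Real.sqrt_mul (by positivity), show τ / 2 * (2 * τ) = τ ^ 2 by ring,
      Real.sqrt_sq hτ.le]
  rw [h, ← Real.rpow_add (by positivity)]
  congr 1
  push_cast
  ring

theorem scaledHermite_succ (hτ : 0 < τ) (n : ℕ) : scaledHermite τ (n + 1) =
    X * scaledHermite τ n - C (τ : ℂ) * derivative (scaledHermite τ n) := by
  have h2 : physHermite (n + 1) = 2 * X * physHermite n - derivative (physHermite n) := rfl
  have h3 : τ * (Real.sqrt (2 * τ))⁻¹ * (2 * (Real.sqrt (2 * τ))⁻¹) = 1 :=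
    mul_inv_sqrt_two_mul hτ
  have h4 : C (τ : ℂ) * C (((Real.sqrt (2 * τ))⁻¹ : ℝ) : ℂ) *
      (2 * C (((Real.sqrt (2 * τ))⁻¹ : ℝ) : ℂ)) = 1 := by
    rw [← C_1, ← Complex.ofReal_one, ← h3]
    push_cast
    simp only [C_mul, map_ofNat]
  rw [derivative_scaledHermite, scaledHermite, rpow_half_succ hτ, h2, sub_comp, mul_comp,
    mul_comp, scaledHermite]
  simp only [Complex.ofReal_mul, C_mul, X_comp, ofNat_comp]
  linear_combination (C ((((τ / 2) ^ ((n : ℝ) / 2) : ℝ) : ℂ)) * X *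
    (physHermite n).comp (C (((Real.sqrt (2 * τ))⁻¹ : ℝ) : ℂ) * X)) * h4

theorem derivative_scaledHermite_succ (hτ : 0 < τ) (n : ℕ) :
    derivative (scaledHermite τ (n + 1)) = C (n + 1 : ℂ) * scaledHermite τ n := by
  rw [derivative_scaledHermite, derivative_physHermite_succ, rpow_half_succ hτ, mul_comp, C_comp,
    scaledHermite, ← mul_assoc (C _), ← mul_assoc (C _), ← C_mul, ← C_mul,
    Complex.ofReal_mul]
  congr 2
  have h3 : τ * (Real.sqrt (2 * τ))⁻¹ * (2 * (Real.sqrt (2 * τ))⁻¹) = 1 :=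
    mul_inv_sqrt_two_mul hτ
  have h4 : (τ : ℂ) * (((Real.sqrt (2 * τ))⁻¹ : ℝ) : ℂ) *
      (2 * (((Real.sqrt (2 * τ))⁻¹ : ℝ) : ℂ)) = 1 := by
    exact_mod_cast h3
  rw [Complex.ofReal_mul]
  linear_combination (((τ / 2) ^ ((n : ℝ) / 2) : ℝ) : ℂ) * (n + 1 : ℂ) * h4

theorem scaledHermite_monic_natDegree (hτ : 0 < τ) (n : ℕ) :
    (scaledHermite τ n).Monic ∧ (scaledHermite τ n).natDegree = n := by
  induction n with
  | zero => rw [scaledHermite_zero]; exact ⟨monic_one, natDegree_one⟩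
  | succ n ih =>
    have hX : (X * scaledHermite τ n).Monic := monic_X.mul ih.1
    have hXd : (X * scaledHermite τ n).natDegree = n + 1 := by
      rw [monic_X.natDegree_mul ih.1, natDegree_X, ih.2, add_comm]
    have hlt : (C (τ : ℂ) * derivative (scaledHermite τ n)).degree
        < (X * scaledHermite τ n).degree := by
      refine degree_lt_degree (lt_of_le_of_lt ((natDegree_C_mul_le _ _).trans
        (natDegree_derivative_le _)) ?_)
      omega
    rw [scaledHermite_succ hτ]
    refine ⟨hX.sub_of_left hlt, ?_⟩
    rw [natDegree_sub_eq_left_of_natDegree_lt, hXd]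
    refine lt_of_le_of_lt ((natDegree_C_mul_le _ _).trans (natDegree_derivative_le _)) ?_
    omega

theorem skewPoly_monic_natDegree (hτ : 0 < τ) (j : ℕ) :
    (skewPoly τ j).Monic ∧ (skewPoly τ j).natDegree = j := by
  unfold skewPoly
  split_ifs with h
  · exact scaledHermite_monic_natDegree hτ j
  · have hj : 0 < j := Nat.pos_of_ne_zero (by rintro rfl; exact h (by simp))
    obtain ⟨h1, h2⟩ := scaledHermite_monic_natDegree hτ j
    have hlt : (C ((j - 1 : ℕ) : ℂ) * scaledHermite τ (j - 2)).natDegree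
        < (scaledHermite τ j).natDegree := by
      refine lt_of_le_of_lt (natDegree_C_mul_le _ _) ?_
      rw [h2, (scaledHermite_monic_natDegree hτ _).2]
      omega
    exact ⟨h1.sub_of_left (degree_lt_degree hlt),
      (natDegree_sub_eq_left_of_natDegree_lt hlt).trans h2⟩

theorem scaledHermite_comp_neg_X (n : ℕ) :
    (scaledHermite τ n).comp (-X) = (-1) ^ n * scaledHermite τ n := by
  have h : (C (((Real.sqrt (2 * τ))⁻¹ : ℝ) : ℂ) * X : ℂ[X]).comp (-X)
      = (-X : ℂ[X]).comp (C (((Real.sqrt (2 * τ))⁻¹ : ℝ) : ℂ) * X) := by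
    simp
  rw [scaledHermite, mul_comp, comp_assoc, h, ← comp_assoc, physHermite_comp_neg_X, mul_comp]
  simp
  ring

theorem skewPoly_comp_neg_X (j : ℕ) :
    (skewPoly τ j).comp (-X) = (-1) ^ j * skewPoly τ j := by
  unfold skewPoly
  split_ifs with h
  · exact scaledHermite_comp_neg_X j
  · rcases j with _ | _ | j
    · exact absurd (by simp) h
    · simpa using scaledHermite_comp_neg_X (τ := τ) 1
    · rw [sub_comp, mul_comp, scaledHermite_comp_neg_X, scaledHermite_comp_neg_X, C_comp]
      simp only [show j + 1 + 1 - 2 = j by omega, show j + 1 + 1 - 1 = j + 1 by omega]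
      ring

/-- The operator `f ↦ f' - z f / (1 + τ)`, which is differentiation conjugated by the weight
`e^{-z² / (2(1+τ))}`. -/
noncomputable def weightedDerivative (τ : ℝ) (f : ℂ[X]) : ℂ[X] :=
  derivative f - C ((1 + τ : ℂ)⁻¹) * (X * f)

/-- Split `z C_{2n} - (1+τ) C_{2n}'` as `(z C_{2n} - τ C_{2n}') - C_{2n}'`: the bracket is
`C_{2n+1}` and the rest is `2n C_{2n-1}`. -/
theorem skewPoly_odd_eq_weightedDerivative (hτ : 0 < τ) (n : ℕ) :
    skewPoly τ (2 * n + 1) =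
      weightedDerivative τ (C (-(1 + τ : ℂ)) * scaledHermite τ (2 * n)) := by
  have hs : (1 + τ : ℂ) ≠ 0 := by
    have : (1 + τ : ℝ) ≠ 0 := by positivity
    exact_mod_cast this
  have hC : C ((1 + τ : ℂ)⁻¹) * C (1 + τ : ℂ) = 1 := by
    rw [← C_mul, inv_mul_cancel₀ hs, C_1]
  have hd : derivative (scaledHermite τ (2 * n)) = C (2 * n : ℂ) * scaledHermite τ (2 * n - 1) := by
    -- At `n = 0` the truncated index `2 * n - 1` is `0`, but its coefficient vanishes.
    rcases n with _ | n
    · simp [scaledHermite_zero]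
    · rw [show 2 * (n + 1) = (2 * n + 1) + 1 by ring, derivative_scaledHermite_succ hτ]
      push_cast
      rw [show (2 * (n : ℂ) + 1 + 1) = 2 * (n + 1) by ring]
  rw [skewPoly_odd, weightedDerivative, scaledHermite_succ hτ, derivative_C_mul, hd, C_neg]
  simp only [C_add, C_1] at hC ⊢
  linear_combination (-(X * scaledHermite τ (2 * n))) * hC

end

/-! ### Integration by parts on the line and on products -/

-- Integrability of both `F` and `F'` forces `F` to vanish at infinity, so no separate decay
-- hypothesis is needed.
open MeasureTheory Filter Topology in
theorem integral_Ioi_of_hasDerivAt_of_integrable {F F' : ℝ → ℂ} {a : ℝ}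
    (hd : ∀ x, HasDerivAt F (F' x) x) (hF' : IntegrableOn F' (Set.Ioi a))
    (hF : IntegrableOn F (Set.Ioi a)) : ∫ x in Set.Ioi a, F' x = -F a := by
  rw [integral_Ioi_of_hasDerivAt_of_tendsto' (fun x _ => hd x) hF'
    (tendsto_zero_of_hasDerivAt_of_integrableOn_Ioi (fun x _ => hd x) hF' hF), zero_sub]

open MeasureTheory Filter Topology in
theorem integral_Iic_of_hasDerivAt_of_integrable {F F' : ℝ → ℂ} {a : ℝ}
    (hd : ∀ x, HasDerivAt F (F' x) x) (hF' : IntegrableOn F' (Set.Iic a))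
    (hF : IntegrableOn F (Set.Iic a)) : ∫ x in Set.Iic a, F' x = F a := by
  rw [integral_Iic_of_hasDerivAt_of_tendsto' (fun x _ => hd x) hF'
    (tendsto_zero_of_hasDerivAt_of_integrableOn_Iic (fun x _ => hd x) hF' hF), sub_zero]

section
open MeasureTheory Set

theorem measurable_realSign : Measurable Real.sign := by
  unfold Real.sign
  exact Measurable.ite measurableSet_Iio measurable_const
    (Measurable.ite measurableSet_Ioi measurable_const measurable_const)

theorem norm_realSign_le_one (x : ℝ) : ‖(Real.sign x : ℂ)‖ ≤ 1 := by
  rcases Real.sign_apply_eq x with h | h | h <;> simp [h]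

/-- In the distributional sense `sgn(y - x)` has `x`-derivative `-2δ_y`; concretely, each side of
`y` contributes `F y`. -/
theorem integral_sign_mul_of_hasDerivAt {F F' : ℝ → ℂ} (hd : ∀ x, HasDerivAt F (F' x) x)
    (hF' : Integrable F') (hF : Integrable F) (y : ℝ) :
    ∫ x, (Real.sign (y - x) : ℂ) * F' x = 2 * F y := by
  have h1 : ∫ x in Iic y, (Real.sign (y - x) : ℂ) * F' x = ∫ x in Iic y, F' x := by
    -- The endpoint is dropped because the sign there is `0`, not `1`.
    rw [integral_Iic_eq_integral_Iio, integral_Iic_eq_integral_Iio]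
    refine setIntegral_congr_fun measurableSet_Iio fun x hx => ?_
    simp [Real.sign_of_pos (sub_pos.2 hx)]
  have h2 : ∫ x in Ioi y, (Real.sign (y - x) : ℂ) * F' x = ∫ x in Ioi y, -F' x := by
    refine setIntegral_congr_fun measurableSet_Ioi fun x hx => ?_
    simp [Real.sign_of_neg (sub_neg.2 hx)]
  have hm : Measurable fun x : ℝ => (Real.sign (y - x) : ℂ) :=
    Complex.measurable_ofReal.comp (measurable_realSign.comp (measurable_const.sub measurable_id))
  have hi : Integrable fun x : ℝ => (Real.sign (y - x) : ℂ) * F' x := by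
    refine hF'.bdd_mul (c := 1) hm.aestronglyMeasurable (Filter.Eventually.of_forall fun x => ?_)
    exact norm_realSign_le_one _
  rw [← intervalIntegral.integral_Iic_add_Ioi hi.integrableOn hi.integrableOn, h1, h2,
    integral_neg, integral_Iic_of_hasDerivAt_of_integrable hd hF'.integrableOn hF.integrableOn,
    integral_Ioi_of_hasDerivAt_of_integrable hd hF'.integrableOn hF.integrableOn]
  ring

theorem integral_prod_eq_zero_of_hasDerivAt_fst {ν : Measure ℝ} [SFinite ν] {F F' : ℝ × ℝ → ℂ}
    (hd : ∀ x y, HasDerivAt (fun t => F (t, y)) (F' (x, y)) x)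
    (hF' : Integrable F' (volume.prod ν)) (hF : Integrable F (volume.prod ν)) :
    ∫ p, F' p ∂(volume.prod ν) = 0 := by
  rw [integral_prod_symm _ hF']
  refine integral_eq_zero_of_ae ?_
  filter_upwards [hF'.prod_left_ae, hF.prod_left_ae] with y h1 h2
  exact integral_eq_zero_of_hasDerivAt_of_integrable (fun x => hd x y) h1 h2

theorem integral_prod_eq_zero_of_hasDerivAt_snd {μ : Measure ℝ} [SFinite μ] {F F' : ℝ × ℝ → ℂ}
    (hd : ∀ x y, HasDerivAt (fun t => F (x, t)) (F' (x, y)) y)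
    (hF' : Integrable F' (μ.prod volume)) (hF : Integrable F (μ.prod volume)) :
    ∫ p, F' p ∂(μ.prod volume) = 0 := by
  rw [← integral_prod_swap]
  exact integral_prod_eq_zero_of_hasDerivAt_fst (F := F ∘ Prod.swap) (F' := F' ∘ Prod.swap)
    (fun x y => hd y x) hF'.swap hF.swap

theorem integral_prod_Ioi_of_hasDerivAt_snd {μ : Measure ℝ} [SFinite μ] {F F' : ℝ × ℝ → ℂ} {a : ℝ}
    (hd : ∀ x y, HasDerivAt (fun t => F (x, t)) (F' (x, y)) y)
    (hF' : Integrable F' (μ.prod (volume.restrict (Ioi a))))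
    (hF : Integrable F (μ.prod (volume.restrict (Ioi a)))) :
    ∫ p, F' p ∂(μ.prod (volume.restrict (Ioi a))) = -∫ x, F (x, a) ∂μ := by
  rw [integral_prod _ hF', ← integral_neg]
  refine integral_congr_ae ?_
  filter_upwards [hF'.prod_right_ae, hF.prod_right_ae] with x h1 h2
  exact integral_Ioi_of_hasDerivAt_of_integrable (fun y => hd x y) h1 h2

/-! ### Gaussian domination, `erfc`, and products `f(z) g(z̄)` -/

theorem integrable_one_add_abs_pow_mul_exp {b : ℝ} (hb : 0 < b) (N : ℕ) :
    Integrable fun x : ℝ => (1 + |x|) ^ N * Real.exp (-b * x ^ 2) := by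
  simp_rw [add_comm (1 : ℝ), add_pow, Finset.sum_mul]
  refine integrable_finsetSum _ fun k _ => ?_
  have h := (integrable_rpow_mul_exp_neg_mul_sq hb
    (show (-1 : ℝ) < (k : ℝ) by have : (0 : ℝ) ≤ k := k.cast_nonneg; linarith)).norm.mul_const
    ((N.choose k : ℝ))
  refine h.congr (Filter.Eventually.of_forall fun x => ?_)
  simp [Real.rpow_natCast]
  ring

theorem integrable_erfc_integrand : Integrable fun t : ℝ => Real.exp (-t ^ 2) := by
  simpa using integrable_exp_neg_mul_sq (one_pos)

theorem hasDerivAt_erfc (x : ℝ) :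
    HasDerivAt erfc (-(2 / Real.sqrt Real.pi) * Real.exp (-x ^ 2)) x := by
  have h : erfc = fun x => 2 / Real.sqrt Real.pi *
      ((∫ t in Ioi (0 : ℝ), Real.exp (-t ^ 2)) - ∫ t in (0 : ℝ)..x, Real.exp (-t ^ 2)) := by
    funext x
    rw [erfc, ← intervalIntegral.integral_interval_add_Ioi (a := 0) (b := x)
      integrable_erfc_integrand.integrableOn integrable_erfc_integrand.integrableOn,
      add_sub_cancel_left]
  have hc : Continuous fun t : ℝ => Real.exp (-t ^ 2) := by fun_prop
  rw [h]
  refine (((hc.integral_hasStrictDerivAt 0 x).hasDerivAt.const_sub _).const_mul _).congr_deriv ?_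
  ring

theorem erfc_nonneg (x : ℝ) : 0 ≤ erfc x :=
  mul_nonneg (by positivity) (integral_nonneg fun _ => (Real.exp_pos _).le)

/-- For `t > x ≥ 0` one has `t² ≥ x² + (t - x)²`. This decay is needed to beat the growing factor
`e^{y²/(1+τ)}`. -/
theorem erfc_le {x : ℝ} (hx : 0 ≤ x) : erfc x ≤ 2 * Real.exp (-x ^ 2) := by
  have hi : Integrable fun t : ℝ => Real.exp (-x ^ 2) * Real.exp (-(t - x) ^ 2) :=
    (integrable_erfc_integrand.comp_sub_right x).const_mul _
  have h1 : ∫ t in Ioi x, Real.exp (-t ^ 2) ≤ Real.exp (-x ^ 2) * Real.sqrt Real.pi := by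
    calc ∫ t in Ioi x, Real.exp (-t ^ 2)
        ≤ ∫ t in Ioi x, Real.exp (-x ^ 2) * Real.exp (-(t - x) ^ 2) := by
          refine setIntegral_mono_on integrable_erfc_integrand.integrableOn hi.integrableOn
            measurableSet_Ioi fun t ht => ?_
          rw [← Real.exp_add]
          refine Real.exp_le_exp.2 ?_
          have : x < t := ht
          nlinarith
      _ ≤ ∫ t, Real.exp (-x ^ 2) * Real.exp (-(t - x) ^ 2) :=
          setIntegral_le_integral hi (Filter.Eventually.of_forall fun t => by positivity)
      _ = _ := by
          rw [integral_const_mul, integral_sub_right_eq_self (fun t => Real.exp (-t ^ 2)) x]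
          have := integral_gaussian 1
          simp only [neg_mul, one_mul, div_one] at this
          rw [this]
  calc erfc x ≤ 2 / Real.sqrt Real.pi * (Real.exp (-x ^ 2) * Real.sqrt Real.pi) :=
        mul_le_mul_of_nonneg_left h1 (by positivity)
    _ = _ := by
        have : Real.sqrt Real.pi ≠ 0 := by positivity
        field_simp

theorem continuous_erfc : Continuous erfc :=
  continuous_iff_continuousAt.2 fun x => (hasDerivAt_erfc x).continuousAt

theorem norm_eval_le (f : ℂ[X]) :
    ∃ K : ℝ, ∃ N : ℕ, 0 ≤ K ∧ ∀ z : ℂ, ‖f.eval z‖ ≤ K * (1 + ‖z‖) ^ N := by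
  refine ⟨∑ i ∈ Finset.range (f.natDegree + 1), ‖f.coeff i‖, f.natDegree,
    Finset.sum_nonneg fun _ _ => norm_nonneg _, fun z => ?_⟩
  rw [eval_eq_sum_range, Finset.sum_mul]
  refine norm_sum_le_of_le _ fun i hi => ?_
  rw [norm_mul, norm_pow]
  gcongr
  calc ‖z‖ ^ i ≤ (1 + ‖z‖) ^ i := by gcongr; linarith
    _ ≤ (1 + ‖z‖) ^ f.natDegree :=
      pow_le_pow_right₀ (by linarith [norm_nonneg z]) (Nat.lt_succ_iff.1 (Finset.mem_range.1 hi))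

/-- The product `f(z) g(z̄)` at the point `z = x + i y`. -/
noncomputable def evalConj (f g : ℂ[X]) (p : ℝ × ℝ) : ℂ :=
  f.eval ((p.1 : ℂ) + Complex.I * p.2) * g.eval ((p.1 : ℂ) - Complex.I * p.2)

theorem continuous_evalConj (f g : ℂ[X]) : Continuous (evalConj f g) := by
  unfold evalConj
  exact (f.continuous.comp (by fun_prop)).mul (g.continuous.comp (by fun_prop))

theorem norm_evalConj_le (f g : ℂ[X]) :
    ∃ K : ℝ, ∃ N : ℕ, 0 ≤ K ∧ ∀ p, ‖evalConj f g p‖ ≤ K * ((1 + |p.1|) ^ N * (1 + |p.2|) ^ N) := by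
  obtain ⟨K, N, hK, h⟩ := norm_eval_le f
  obtain ⟨K', N', hK', h'⟩ := norm_eval_le g
  refine ⟨K * K', N + N', mul_nonneg hK hK', fun p => ?_⟩
  -- A product bound separates the variables, so integrability reduces to one dimension.
  have key : ∀ z : ℂ, ‖z‖ ≤ |p.1| + |p.2| → 1 + ‖z‖ ≤ (1 + |p.1|) * (1 + |p.2|) := by
    intro z hz
    nlinarith [abs_nonneg p.1, abs_nonneg p.2, mul_nonneg (abs_nonneg p.1) (abs_nonneg p.2)]
  have h1 : ‖(p.1 : ℂ) + Complex.I * p.2‖ ≤ |p.1| + |p.2| :=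
    (norm_add_le _ _).trans (by simp)
  have h2 : ‖(p.1 : ℂ) - Complex.I * p.2‖ ≤ |p.1| + |p.2| :=
    (norm_sub_le _ _).trans (by simp)
  rw [evalConj, norm_mul]
  calc _ ≤ (K * ((1 + |p.1|) * (1 + |p.2|)) ^ N) * (K' * ((1 + |p.1|) * (1 + |p.2|)) ^ N') := by
        refine mul_le_mul ((h _).trans ?_) ((h' _).trans ?_) (norm_nonneg _) (by positivity)
        · have := key _ h1
          gcongr
        · have := key _ h2
          gcongr
    _ = _ := by rw [pow_add, pow_add, mul_pow, mul_pow]; ring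

theorem hasDerivAt_eval_line (f : ℂ[X]) (a b : ℂ) (t : ℝ) :
    HasDerivAt (fun s : ℝ => f.eval (a + b * s)) (b * (derivative f).eval (a + b * t)) t := by
  have h := (f.hasDerivAt (a + b * t)).comp t
    (((hasDerivAt_id (t : ℂ)).comp_ofReal.const_mul b).const_add a)
  simpa [Function.comp_def, mul_comp, mul_comm] using h

theorem hasDerivAt_evalConj_fst (f g : ℂ[X]) (x y : ℝ) :
    HasDerivAt (fun t => evalConj f g (t, y))
      (evalConj (derivative f) g (x, y) + evalConj f (derivative g) (x, y)) x := by
  have h1 := hasDerivAt_eval_line f (Complex.I * y) 1 x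
  have h2 := hasDerivAt_eval_line g (-(Complex.I * y)) 1 x
  have e : (fun t : ℝ => evalConj f g (t, y)) = (fun s : ℝ => f.eval (Complex.I * y + 1 * s)) *
      fun s : ℝ => g.eval (-(Complex.I * y) + 1 * s) := by
    funext t
    simp [evalConj, add_comm, sub_eq_add_neg]
  rw [e]
  refine (h1.mul h2).congr_deriv ?_
  simp [evalConj, add_comm, sub_eq_add_neg]

theorem hasDerivAt_evalConj_snd (f g : ℂ[X]) (x y : ℝ) :
    HasDerivAt (fun t => evalConj f g (x, t))
      (Complex.I * (evalConj (derivative f) g (x, y) - evalConj f (derivative g) (x, y))) y := by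
  have h1 := hasDerivAt_eval_line f x Complex.I y
  have h2 := hasDerivAt_eval_line g x (-Complex.I) y
  have e : (fun t : ℝ => evalConj f g (x, t)) = (fun s : ℝ => f.eval ((x : ℂ) + Complex.I * s)) *
      fun s : ℝ => g.eval ((x : ℂ) + -Complex.I * s) := by
    funext t
    simp [evalConj, sub_eq_add_neg]
  rw [e]
  refine (h1.mul h2).congr_deriv ?_
  simp only [evalConj, sub_eq_add_neg, neg_mul]
  ring

/-- Allowing measures below Lebesgue measure treats the plane and the half plane together. -/
theorem integrable_of_norm_le_gaussian {μ ν : Measure ℝ} [SFinite μ] [SFinite ν]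
    (hμ : μ ≤ volume) (hν : ν ≤ volume) {a b : ℝ} (ha : 0 < a) (hb : 0 < b) {F : ℝ × ℝ → ℂ}
    {K : ℝ} {N : ℕ} (hF : AEStronglyMeasurable F (μ.prod ν))
    (h : ∀ᵐ p ∂(μ.prod ν), ‖F p‖ ≤ K * ((1 + |p.1|) ^ N * (1 + |p.2|) ^ N) *
      (Real.exp (-a * p.1 ^ 2) * Real.exp (-b * p.2 ^ 2))) : Integrable F (μ.prod ν) := by
  have hi := (((integrable_one_add_abs_pow_mul_exp ha N).mono_measure hμ).mul_prod
    ((integrable_one_add_abs_pow_mul_exp hb N).mono_measure hν)).const_mul K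
  refine hi.mono' hF (h.mono fun p hp => hp.trans (le_of_eq ?_))
  ring

end

/-! ### Orthogonality of the scaled Hermite polynomials in the plane -/

section
open MeasureTheory Set
variable {τ : ℝ}

/-- The measure `dx dy` on the upper half plane. -/
noncomputable abbrev upperVolume : Measure (ℝ × ℝ) :=
  (volume : Measure ℝ).prod (volume.restrict (Ioi (0 : ℝ)))

/-- The Gaussian weight `e^{-x²/(1+τ) - y²/(1-τ)}` of the elliptic ensemble. -/
noncomputable def gaussianWeight (τ : ℝ) (p : ℝ × ℝ) : ℝ :=
  Real.exp (-(1 + τ)⁻¹ * p.1 ^ 2) * Real.exp (-(1 - τ)⁻¹ * p.2 ^ 2)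

/-- The weight `e^{(y²-x²)/(1+τ)} erfc(√(2/(1-τ²)) y)`. -/
noncomputable def erfcWeight (τ : ℝ) (p : ℝ × ℝ) : ℝ :=
  Real.exp ((p.2 ^ 2 - p.1 ^ 2) / (1 + τ)) * erfc (Real.sqrt (2 / (1 - τ ^ 2)) * p.2)

/-- Because `1/(1+τ) - 2/(1-τ²) = -1/(1-τ)`, both the bound on `erfc` and its derivative produce
exactly the elliptic Gaussian. -/
theorem exp_mul_exp_neg_sq (hτ0 : 0 < τ) (hτ1 : τ < 1) (p : ℝ × ℝ) :
    Real.exp ((p.2 ^ 2 - p.1 ^ 2) / (1 + τ)) *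
      Real.exp (-(Real.sqrt (2 / (1 - τ ^ 2)) * p.2) ^ 2) = gaussianWeight τ p := by
  have h1 : 0 < 1 - τ ^ 2 := by nlinarith
  have h2 : (1 : ℝ) - τ ≠ 0 := by linarith
  have h3 : (1 : ℝ) + τ ≠ 0 := by linarith
  have h4 : 1 - τ ^ 2 = (1 - τ) * (1 + τ) := by ring
  rw [gaussianWeight, ← Real.exp_add, ← Real.exp_add, mul_pow, Real.sq_sqrt (by positivity), h4]
  congr 1
  field_simp
  ring

theorem continuous_gaussianWeight : Continuous (gaussianWeight τ) := by
  unfold gaussianWeight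
  fun_prop

theorem continuous_erfcWeight : Continuous (erfcWeight τ) := by
  unfold erfcWeight
  have := continuous_erfc
  fun_prop

theorem integrable_gaussianWeight_mul {μ ν : Measure ℝ} [SFinite μ] [SFinite ν]
    (hμ : μ ≤ volume) (hν : ν ≤ volume) (hτ0 : 0 < τ) (hτ1 : τ < 1) (f g : ℂ[X]) :
    Integrable (fun p => (gaussianWeight τ p : ℂ) * evalConj f g p) (μ.prod ν) := by
  obtain ⟨K, N, hK, h⟩ := norm_evalConj_le f g
  refine integrable_of_norm_le_gaussian (a := (1 + τ)⁻¹) (b := (1 - τ)⁻¹) (K := K) (N := N) hμ hν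
    (inv_pos.2 (by linarith)) (inv_pos.2 (by linarith)) ?_ (Filter.Eventually.of_forall fun p => ?_)
  · exact ((Complex.continuous_ofReal.comp continuous_gaussianWeight).mul
      (continuous_evalConj f g)).aestronglyMeasurable
  · have h0 : 0 ≤ gaussianWeight τ p := by unfold gaussianWeight; positivity
    rw [norm_mul, Complex.norm_real, Real.norm_of_nonneg h0, mul_comm, gaussianWeight]
    exact mul_le_mul_of_nonneg_right (h p) (by positivity)

theorem integrable_erfcWeight_mul (hτ0 : 0 < τ) (hτ1 : τ < 1) (f g : ℂ[X]) :
    Integrable (fun p => (erfcWeight τ p : ℂ) * evalConj f g p) upperVolume := by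
  obtain ⟨K, N, hK, h⟩ := norm_evalConj_le f g
  refine integrable_of_norm_le_gaussian (a := (1 + τ)⁻¹) (b := (1 - τ)⁻¹) (K := 2 * K) (N := N)
    le_rfl Measure.restrict_le_self
    (inv_pos.2 (by linarith)) (inv_pos.2 (by linarith)) ?_ ?_
  · exact ((Complex.continuous_ofReal.comp continuous_erfcWeight).mul
      (continuous_evalConj f g)).aestronglyMeasurable
  · have hy : ∀ᵐ p ∂upperVolume, p.2 ∈ Ioi (0 : ℝ) :=
      Measure.quasiMeasurePreserving_snd.ae (ae_restrict_mem measurableSet_Ioi)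
    filter_upwards [hy] with p hp
    have h0 : 0 ≤ erfcWeight τ p := mul_nonneg (Real.exp_pos _).le (erfc_nonneg _)
    have h1 : erfcWeight τ p ≤ 2 * gaussianWeight τ p := by
      rw [← exp_mul_exp_neg_sq hτ0 hτ1, mul_left_comm]
      exact mul_le_mul_of_nonneg_left
        (erfc_le (mul_nonneg (Real.sqrt_nonneg _) (le_of_lt hp))) (Real.exp_pos _).le
    have h2 : 0 ≤ gaussianWeight τ p := by unfold gaussianWeight; positivity
    rw [norm_mul, Complex.norm_real, Real.norm_of_nonneg h0]
    refine (mul_le_mul h1 (h p) (norm_nonneg _) (by positivity)).trans (le_of_eq ?_)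
    rw [gaussianWeight]
    ring

theorem evalConj_X_left (f g : ℂ[X]) (p : ℝ × ℝ) :
    evalConj (X * f) g p = (p.1 + Complex.I * p.2) * evalConj f g p := by
  simp [evalConj]; ring

theorem evalConj_X_right (f g : ℂ[X]) (p : ℝ × ℝ) :
    evalConj f (X * g) p = (p.1 - Complex.I * p.2) * evalConj f g p := by
  simp [evalConj]; ring

theorem evalConj_sub_left (f f' g : ℂ[X]) (p : ℝ × ℝ) :
    evalConj (f - f') g p = evalConj f g p - evalConj f' g p := by
  simp [evalConj]; ring

theorem evalConj_sub_right (f g g' : ℂ[X]) (p : ℝ × ℝ) :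
    evalConj f (g - g') p = evalConj f g p - evalConj f g' p := by
  simp [evalConj]; ring

theorem evalConj_C_mul_left (c : ℂ) (f g : ℂ[X]) (p : ℝ × ℝ) :
    evalConj (C c * f) g p = c * evalConj f g p := by
  simp [evalConj]; ring

theorem evalConj_C_mul_right (c : ℂ) (f g : ℂ[X]) (p : ℝ × ℝ) :
    evalConj f (C c * g) p = c * evalConj f g p := by
  simp [evalConj]; ring

/-- The bilinear pairing `∫∫ e^{-x²/(1+τ) - y²/(1-τ)} f(z) g(z̄) dx dy`. -/
noncomputable def ellipticPairing (τ : ℝ) (f g : ℂ[X]) : ℂ :=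
  ∫ p, (gaussianWeight τ p : ℂ) * evalConj f g p ∂((volume : Measure ℝ).prod (volume : Measure ℝ))

theorem hasDerivAt_gaussian (a t : ℝ) :
    HasDerivAt (fun t : ℝ => (Real.exp (a * t ^ 2) : ℂ)) (2 * a * t * Real.exp (a * t ^ 2)) t := by
  have h := (((hasDerivAt_pow 2 t).const_mul a).exp).ofReal_comp
  refine h.congr_deriv ?_
  push_cast
  ring

theorem hasDerivAt_gaussianWeight_mul_fst (f g : ℂ[X]) (x y : ℝ) :
    HasDerivAt (fun t => (gaussianWeight τ (t, y) : ℂ) * evalConj f g (t, y))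
      (gaussianWeight τ (x, y) * evalConj (derivative f) g (x, y)
        + gaussianWeight τ (x, y) * evalConj f (derivative g) (x, y)
        - (1 + τ : ℂ)⁻¹ * (gaussianWeight τ (x, y) * evalConj (X * f) g (x, y)
          + gaussianWeight τ (x, y) * evalConj f (X * g) (x, y))) x := by
  have h := ((hasDerivAt_gaussian (-(1 + τ)⁻¹) x).mul_const
    (Real.exp (-(1 - τ)⁻¹ * y ^ 2) : ℂ)).fun_mul (hasDerivAt_evalConj_fst f g x y)
  simp only [gaussianWeight, Complex.ofReal_mul]
  refine h.congr_deriv ?_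
  rw [evalConj_X_left, evalConj_X_right]
  push_cast
  ring

theorem hasDerivAt_gaussianWeight_mul_snd (f g : ℂ[X]) (x y : ℝ) :
    HasDerivAt (fun t => (gaussianWeight τ (x, t) : ℂ) * evalConj f g (x, t))
      (Complex.I * (gaussianWeight τ (x, y) * evalConj (derivative f) g (x, y)
        - gaussianWeight τ (x, y) * evalConj f (derivative g) (x, y)
        + (1 - τ : ℂ)⁻¹ * (gaussianWeight τ (x, y) * evalConj (X * f) g (x, y)
          - gaussianWeight τ (x, y) * evalConj f (X * g) (x, y)))) y := by
  have h := ((hasDerivAt_gaussian (-(1 - τ)⁻¹) y).const_mul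
    (Real.exp (-(1 + τ)⁻¹ * x ^ 2) : ℂ)).fun_mul (hasDerivAt_evalConj_snd f g x y)
  simp only [gaussianWeight, Complex.ofReal_mul]
  refine h.congr_deriv ?_
  rw [evalConj_X_left, evalConj_X_right]
  push_cast
  linear_combination (-2 * (1 - τ : ℂ)⁻¹ * y * Complex.exp (-(1 + (τ : ℂ))⁻¹ * x ^ 2) *
    Complex.exp (-(1 - (τ : ℂ))⁻¹ * y ^ 2) * evalConj f g (x, y)) * Complex.I_sq

/-- The total `x`-derivative determines the sum of the pairings of `(zf, g)` and `(f, zg)`, the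
`y`-derivative their difference; half the total of the two isolates the first. -/
theorem ellipticPairing_X_mul (hτ0 : 0 < τ) (hτ1 : τ < 1) (f g : ℂ[X]) :
    ellipticPairing τ (X * f) g =
      τ * ellipticPairing τ (derivative f) g + ellipticPairing τ f (derivative g) := by
  have hi := integrable_gaussianWeight_mul (τ := τ) (le_refl volume) (le_refl volume) hτ0 hτ1
  have h1 := integral_prod_eq_zero_of_hasDerivAt_fst (ν := volume)
    (hasDerivAt_gaussianWeight_mul_fst (τ := τ) f g)
    (((hi (derivative f) g).add (hi f (derivative g))).sub
      (((hi (X * f) g).add (hi f (X * g))).const_mul _)) (hi f g)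
  have h2 := integral_prod_eq_zero_of_hasDerivAt_snd (μ := volume)
    (hasDerivAt_gaussianWeight_mul_snd (τ := τ) f g)
    ((((hi (derivative f) g).sub (hi f (derivative g))).add
      (((hi (X * f) g).sub (hi f (X * g))).const_mul _)).const_mul _) (hi f g)
  rw [integral_sub' ((hi (derivative f) g).add (hi f (derivative g)))
      (((hi (X * f) g).add (hi f (X * g))).const_mul _),
    integral_add' (hi _ _) (hi _ _), integral_const_mul, integral_add' (hi _ _) (hi _ _)] at h1
  rw [integral_const_mul, integral_add' ((hi (derivative f) g).sub (hi f (derivative g)))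
      (((hi (X * f) g).sub (hi f (X * g))).const_mul _),
    integral_sub' (hi _ _) (hi _ _), integral_const_mul, integral_sub' (hi _ _) (hi _ _)] at h2
  have h2 := (mul_eq_zero.1 h2).resolve_left Complex.I_ne_zero
  have e : ∀ f g : ℂ[X], ∫ p, (gaussianWeight τ p : ℂ) * evalConj f g p
      ∂((volume : Measure ℝ).prod (volume : Measure ℝ)) = ellipticPairing τ f g := fun _ _ => rfl
  simp only [e] at h1 h2
  have e1 : (1 + τ : ℂ) * (1 + τ : ℂ)⁻¹ = 1 := mul_inv_cancel₀ (by
    exact_mod_cast (by linarith : (1 : ℝ) + τ ≠ 0))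
  have e2 : (1 - τ : ℂ) * (1 - τ : ℂ)⁻¹ = 1 := mul_inv_cancel₀ (by
    exact_mod_cast (by linarith : (1 : ℝ) - τ ≠ 0))
  linear_combination (-(1 + τ : ℂ) / 2) * h1 + ((1 - τ : ℂ) / 2) * h2
    - (ellipticPairing τ (X * f) g + ellipticPairing τ f (X * g)) / 2 * e1
    - (ellipticPairing τ (X * f) g - ellipticPairing τ f (X * g)) / 2 * e2

theorem ellipticPairing_sub_left (hτ0 : 0 < τ) (hτ1 : τ < 1) (f f' g : ℂ[X]) :
    ellipticPairing τ (f - f') g = ellipticPairing τ f g - ellipticPairing τ f' g := by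
  have hi := integrable_gaussianWeight_mul (τ := τ) (le_refl volume) (le_refl volume) hτ0 hτ1
  simp only [ellipticPairing, evalConj_sub_left, mul_sub]
  exact integral_sub (hi _ _) (hi _ _)

theorem ellipticPairing_C_mul_left (c : ℂ) (f g : ℂ[X]) :
    ellipticPairing τ (C c * f) g = c * ellipticPairing τ f g := by
  simp only [ellipticPairing, evalConj_C_mul_left, mul_left_comm _ c]
  exact integral_const_mul _ _

theorem ellipticPairing_C_mul_right (c : ℂ) (f g : ℂ[X]) :
    ellipticPairing τ f (C c * g) = c * ellipticPairing τ f g := by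
  simp only [ellipticPairing, evalConj_C_mul_right, mul_left_comm _ c]
  exact integral_const_mul _ _

/-- Reflection `y ↦ -y` preserves the weight and exchanges `z` with `z̄`, hence `f` with `g`. -/
theorem ellipticPairing_eq_upper (hτ0 : 0 < τ) (hτ1 : τ < 1) (f g : ℂ[X]) :
    ellipticPairing τ f g = (∫ p, (gaussianWeight τ p : ℂ) * evalConj f g p ∂upperVolume) +
      ∫ p, (gaussianWeight τ p : ℂ) * evalConj g f p ∂upperVolume := by
  have hi := integrable_gaussianWeight_mul (τ := τ) (le_refl volume) (le_refl volume) hτ0 hτ1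
  have hu := integrable_gaussianWeight_mul (τ := τ) (le_refl volume)
    (Measure.restrict_le_self (s := Ioi (0 : ℝ))) hτ0 hτ1
  rw [← integral_add' (hu f g) (hu g f), integral_prod _ ((hu f g).add (hu g f)), ellipticPairing,
    integral_prod _ (hi f g)]
  refine integral_congr_ae ?_
  filter_upwards [(hi f g).prod_right_ae, (hu f g).prod_right_ae, (hu g f).prod_right_ae]
    with x h1 h2 h3
  have e : ∫ y in Iic (0 : ℝ), (gaussianWeight τ (x, y) : ℂ) * evalConj f g (x, y) =
      ∫ y in Ioi (0 : ℝ), (gaussianWeight τ (x, y) : ℂ) * evalConj g f (x, y) := by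
    have := integral_comp_neg_Ioi 0 fun y => (gaussianWeight τ (x, y) : ℂ) * evalConj f g (x, y)
    rw [neg_zero] at this
    rw [← this]
    congr 1
    funext y
    simp [gaussianWeight, evalConj, sub_eq_add_neg, mul_comm]
  simp only [Pi.add_apply]
  rw [integral_add h2 h3, ← e, add_comm]
  exact (intervalIntegral.integral_Iic_add_Ioi h1.integrableOn h1.integrableOn).symm

theorem ellipticPairing_comm (hτ0 : 0 < τ) (hτ1 : τ < 1) (f g : ℂ[X]) :
    ellipticPairing τ f g = ellipticPairing τ g f := by
  rw [ellipticPairing_eq_upper hτ0 hτ1, ellipticPairing_eq_upper hτ0 hτ1, add_comm]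

theorem ellipticPairing_one_one (hτ1 : τ < 1) :
    ellipticPairing τ 1 1 = (Real.pi * Real.sqrt (1 - τ ^ 2) : ℝ) := by
  have h : ∀ p : ℝ × ℝ, (gaussianWeight τ p : ℂ) * evalConj 1 1 p =
      ((Real.exp (-(1 + τ)⁻¹ * p.1 ^ 2) * Real.exp (-(1 - τ)⁻¹ * p.2 ^ 2) : ℝ) : ℂ) := fun p => by
    simp [evalConj, gaussianWeight]
  simp only [ellipticPairing, h]
  rw [integral_complex_ofReal,
    integral_prod_mul (fun x : ℝ => Real.exp (-(1 + τ)⁻¹ * x ^ 2))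
      (fun y : ℝ => Real.exp (-(1 - τ)⁻¹ * y ^ 2)), integral_gaussian, integral_gaussian,
    div_inv_eq_mul, div_inv_eq_mul, ← Real.sqrt_mul' _ (by have := Real.pi_pos; nlinarith),
    show Real.pi * (1 + τ) * (Real.pi * (1 - τ)) = Real.pi ^ 2 * (1 - τ ^ 2) by ring,
    Real.sqrt_mul (by positivity), Real.sqrt_sq Real.pi_pos.le]

/-- The `τ f'` term in the raising recurrence cancels the one from integration by parts, leaving the
derivative on `g` alone. -/
theorem ellipticPairing_scaledHermite_succ (hτ0 : 0 < τ) (hτ1 : τ < 1) (n : ℕ) (g : ℂ[X]) :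
    ellipticPairing τ (scaledHermite τ (n + 1)) g =
      ellipticPairing τ (scaledHermite τ n) (derivative g) := by
  rw [scaledHermite_succ hτ0, ellipticPairing_sub_left hτ0 hτ1, ellipticPairing_X_mul hτ0 hτ1,
    ellipticPairing_C_mul_left]
  ring

theorem ellipticPairing_scaledHermite_zero (hτ0 : 0 < τ) (hτ1 : τ < 1) (n : ℕ) :
    ellipticPairing τ (scaledHermite τ (n + 1)) (scaledHermite τ 0) = 0 := by
  rw [ellipticPairing_scaledHermite_succ hτ0 hτ1, scaledHermite_zero, derivative_one,
    show (0 : ℂ[X]) = C 0 * 0 by simp, ellipticPairing_C_mul_right, zero_mul]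

theorem ellipticPairing_scaledHermite (hτ0 : 0 < τ) (hτ1 : τ < 1) (n m : ℕ) :
    ellipticPairing τ (scaledHermite τ n) (scaledHermite τ m) =
      if n = m then (n.factorial : ℂ) * (Real.pi * Real.sqrt (1 - τ ^ 2) : ℝ) else 0 := by
  induction n generalizing m with
  | zero =>
    rcases m with _ | m
    · simp [scaledHermite_zero, ellipticPairing_one_one hτ1]
    · rw [ellipticPairing_comm hτ0 hτ1, ellipticPairing_scaledHermite_zero hτ0 hτ1]
      simp
  | succ n ih =>
    rcases m with _ | m
    · rw [ellipticPairing_scaledHermite_zero hτ0 hτ1]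
      simp
    · rw [ellipticPairing_scaledHermite_succ hτ0 hτ1, derivative_scaledHermite_succ hτ0,
        ellipticPairing_C_mul_right, ih]
      simp only [Nat.add_right_cancel_iff]
      split_ifs with h
      · subst h
        rw [Nat.factorial_succ]
        push_cast
        ring
      · simp

end

/-! ### The skew product of a weighted derivative -/

section
open MeasureTheory Set
variable {τ : ℝ}

theorem evalConj_weightedDerivative_left (f g : ℂ[X]) (p : ℝ × ℝ) :
    evalConj (weightedDerivative τ f) g p =
      evalConj (derivative f) g p - (1 + τ : ℂ)⁻¹ * (p.1 + Complex.I * p.2) * evalConj f g p := by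
  rw [weightedDerivative, evalConj_sub_left, evalConj_C_mul_left, evalConj_X_left, mul_assoc]

theorem evalConj_weightedDerivative_right (f g : ℂ[X]) (p : ℝ × ℝ) :
    evalConj f (weightedDerivative τ g) p =
      evalConj f (derivative g) p - (1 + τ : ℂ)⁻¹ * (p.1 - Complex.I * p.2) * evalConj f g p := by
  rw [weightedDerivative, evalConj_sub_right, evalConj_C_mul_right, evalConj_X_right, mul_assoc]

theorem erfcWeight_eq (x y : ℝ) : (erfcWeight τ (x, y) : ℂ) =
    (Real.exp (-(1 + τ)⁻¹ * x ^ 2) : ℂ) * (Real.exp ((1 + τ)⁻¹ * y ^ 2) : ℂ) *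
      (erfc (Real.sqrt (2 / (1 - τ ^ 2)) * y) : ℂ) := by
  rw [erfcWeight, ← Complex.ofReal_mul, ← Real.exp_add, ← Complex.ofReal_mul]
  congr 3
  ring

theorem hasDerivAt_erfcWeight_mul_fst (f g : ℂ[X]) (x y : ℝ) :
    HasDerivAt (fun t => (erfcWeight τ (t, y) : ℂ) * evalConj f g (t, y))
      (erfcWeight τ (x, y) * evalConj (weightedDerivative τ f) g (x, y)
        + erfcWeight τ (x, y) * evalConj f (weightedDerivative τ g) (x, y)) x := by
  have h := (((hasDerivAt_gaussian (-(1 + τ)⁻¹) x).mul_const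
    (Real.exp ((1 + τ)⁻¹ * y ^ 2) : ℂ)).mul_const
      (erfc (Real.sqrt (2 / (1 - τ ^ 2)) * y) : ℂ)).fun_mul (hasDerivAt_evalConj_fst f g x y)
  simp only [erfcWeight_eq]
  refine h.congr_deriv ?_
  rw [evalConj_weightedDerivative_left, evalConj_weightedDerivative_right]
  push_cast
  ring

/-- The constant `2c/√π`, `c = √(2/(1-τ²))`. -/
noncomputable def erfcSlope (τ : ℝ) : ℝ :=
  2 / Real.sqrt Real.pi * Real.sqrt (2 / (1 - τ ^ 2))

theorem hasDerivAt_erfcWeight_mul_snd (hτ0 : 0 < τ) (hτ1 : τ < 1) (f g : ℂ[X]) (x y : ℝ) :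
    HasDerivAt (fun t => (erfcWeight τ (x, t) : ℂ) * evalConj f g (x, t))
      (Complex.I * (erfcWeight τ (x, y) * evalConj (weightedDerivative τ f) g (x, y)
        - erfcWeight τ (x, y) * evalConj f (weightedDerivative τ g) (x, y))
        - erfcSlope τ * (gaussianWeight τ (x, y) * evalConj f g (x, y))) y := by
  have h0 : HasDerivAt (fun t : ℝ => (erfc (Real.sqrt (2 / (1 - τ ^ 2)) * t) : ℂ))
      (-erfcSlope τ * Real.exp (-(Real.sqrt (2 / (1 - τ ^ 2)) * y) ^ 2)) y := by
    have := ((hasDerivAt_erfc (Real.sqrt (2 / (1 - τ ^ 2)) * y)).comp y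
      ((hasDerivAt_id y).const_mul (Real.sqrt (2 / (1 - τ ^ 2))))).ofReal_comp
    refine this.congr_deriv ?_
    rw [erfcSlope]
    push_cast
    ring
  have h := (((hasDerivAt_gaussian (1 + τ)⁻¹ y).const_mul
    (Real.exp (-(1 + τ)⁻¹ * x ^ 2) : ℂ)).fun_mul h0).fun_mul (hasDerivAt_evalConj_snd f g x y)
  have hw : (gaussianWeight τ (x, y) : ℂ) = (Real.exp (-(1 + τ)⁻¹ * x ^ 2) : ℂ) *
      (Real.exp ((1 + τ)⁻¹ * y ^ 2) : ℂ) *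
        Real.exp (-(Real.sqrt (2 / (1 - τ ^ 2)) * y) ^ 2) := by
    rw [← exp_mul_exp_neg_sq hτ0 hτ1]
    simp only [← Complex.ofReal_mul, ← Real.exp_add]
    congr 2
    ring
  simp only [erfcWeight_eq]
  simp only [← mul_assoc] at h
  refine h.congr_deriv ?_
  rw [evalConj_weightedDerivative_left, evalConj_weightedDerivative_right, hw]
  simp only [Complex.ofReal_inv, Complex.ofReal_add, Complex.ofReal_one]
  linear_combination (2 * (1 + (τ : ℂ))⁻¹ * y * (Real.exp (-(1 + τ)⁻¹ * x ^ 2) : ℂ) *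
    (Real.exp ((1 + τ)⁻¹ * y ^ 2) : ℂ) * (erfc (Real.sqrt (2 / (1 - τ ^ 2)) * y) : ℂ) *
    evalConj f g (x, y)) * Complex.I_sq

/-- The bilinear half-plane integral with the error function weight. -/
noncomputable def erfcPairing (τ : ℝ) (f g : ℂ[X]) : ℂ :=
  ∫ p, (erfcWeight τ p : ℂ) * evalConj f g p ∂upperVolume

theorem erfcPairing_weightedDerivative_add (hτ0 : 0 < τ) (hτ1 : τ < 1) (f g : ℂ[X]) :
    erfcPairing τ (weightedDerivative τ f) g + erfcPairing τ f (weightedDerivative τ g) = 0 := by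
  have hi := integrable_erfcWeight_mul hτ0 hτ1
  have h := integral_prod_eq_zero_of_hasDerivAt_fst (hasDerivAt_erfcWeight_mul_fst (τ := τ) f g)
    ((hi (weightedDerivative τ f) g).add (hi f (weightedDerivative τ g))) (hi f g)
  rwa [integral_add' (hi _ _) (hi _ _)] at h

theorem erfc_zero : erfc 0 = 1 := by
  have h := integral_gaussian_Ioi 1
  simp only [neg_mul, one_mul, div_one] at h
  rw [erfc, h]
  have : Real.sqrt Real.pi ≠ 0 := by positivity
  field_simp

/-- Integration in `y` gives two extra terms: the Gaussian from differentiating `erfc`, and the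
boundary term at `y = 0`, where `erfc 0 = 1`. -/
theorem erfcPairing_weightedDerivative_sub (hτ0 : 0 < τ) (hτ1 : τ < 1) (f g : ℂ[X]) :
    Complex.I * (erfcPairing τ (weightedDerivative τ f) g
        - erfcPairing τ f (weightedDerivative τ g)) =
      erfcSlope τ * (∫ p, (gaussianWeight τ p : ℂ) * evalConj f g p ∂upperVolume)
        - ∫ x : ℝ, (Real.exp (-(1 + τ)⁻¹ * x ^ 2) : ℂ) * (f.eval (x : ℂ) * g.eval (x : ℂ)) := by
  have hi := integrable_erfcWeight_mul hτ0 hτ1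
  have hu := integrable_gaussianWeight_mul (τ := τ) (le_refl volume)
    (Measure.restrict_le_self (s := Ioi (0 : ℝ))) hτ0 hτ1
  have h := integral_prod_Ioi_of_hasDerivAt_snd (hasDerivAt_erfcWeight_mul_snd hτ0 hτ1 f g)
    ((((hi (weightedDerivative τ f) g).sub (hi f (weightedDerivative τ g))).const_mul _).sub
      ((hu f g).const_mul _)) (hi f g)
  rw [integral_sub' (((hi (weightedDerivative τ f) g).sub
      (hi f (weightedDerivative τ g))).const_mul _) ((hu f g).const_mul _), integral_const_mul,
    integral_const_mul, integral_sub' (hi _ _) (hi _ _)] at h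
  have hb : ∀ x : ℝ, (erfcWeight τ (x, 0) : ℂ) * evalConj f g (x, 0) =
      (Real.exp (-(1 + τ)⁻¹ * x ^ 2) : ℂ) * (f.eval (x : ℂ) * g.eval (x : ℂ)) := fun x => by
    rw [erfcWeight_eq]
    simp [erfc_zero, evalConj]
  simp only [hb] at h
  rw [erfcPairing, erfcPairing]
  linear_combination h

theorem complexIntegrand_eq (f g : ℂ[X]) (p : ℝ × ℝ) : complexIntegrand τ f g p.1 p.2 =
    (erfcWeight τ p : ℂ) * evalConj f g p - (erfcWeight τ p : ℂ) * evalConj g f p := by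
  simp only [complexIntegrand, erfcWeight, evalConj, Complex.ofReal_mul]
  ring

theorem integrable_complexIntegrand (hτ0 : 0 < τ) (hτ1 : τ < 1) (f g : ℂ[X]) :
    Integrable (fun p : ℝ × ℝ => complexIntegrand τ f g p.1 p.2) upperVolume := by
  simp only [complexIntegrand_eq]
  exact (integrable_erfcWeight_mul hτ0 hτ1 f g).sub (integrable_erfcWeight_mul hτ0 hτ1 g f)

theorem skewInnerComplex_eq (hτ0 : 0 < τ) (hτ1 : τ < 1) (f g : ℂ[X]) :
    skewInnerComplex τ f g = 2 * Complex.I * (erfcPairing τ f g - erfcPairing τ g f) := by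
  rw [skewInnerComplex, erfcPairing, erfcPairing,
    ← integral_sub (integrable_erfcWeight_mul hτ0 hτ1 f g) (integrable_erfcWeight_mul hτ0 hτ1 g f)]
  have h := integral_prod _ (integrable_complexIntegrand hτ0 hτ1 f g)
  rw [← h]
  simp only [complexIntegrand_eq]

theorem skewInnerComplex_weightedDerivative (hτ0 : 0 < τ) (hτ1 : τ < 1) (f g : ℂ[X]) :
    skewInnerComplex τ (weightedDerivative τ f) g = erfcSlope τ * ellipticPairing τ f g -
      2 * ∫ x : ℝ, (Real.exp (-(1 + τ)⁻¹ * x ^ 2) : ℂ) * (f.eval (x : ℂ) * g.eval (x : ℂ)) := by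
  have h1 := erfcPairing_weightedDerivative_add hτ0 hτ1 f g
  have h2 := erfcPairing_weightedDerivative_add hτ0 hτ1 g f
  have h3 := erfcPairing_weightedDerivative_sub hτ0 hτ1 f g
  have h4 := erfcPairing_weightedDerivative_sub hτ0 hτ1 g f
  simp only [mul_comm (g.eval _)] at h4
  rw [skewInnerComplex_eq hτ0 hτ1, ellipticPairing_eq_upper hτ0 hτ1]
  -- The sum and difference relations for `(f, g)` isolate the pairing of `D f` with `g`; those for
  -- `(g, f)` isolate the swapped pairing.
  linear_combination Complex.I * h1 - Complex.I * h2 + h3 + h4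

theorem realIntegrand_eq (f g : ℂ[X]) (x y : ℝ) : realIntegrand τ f g x y =
    ((Real.exp (-(2 * (1 + τ))⁻¹ * y ^ 2) : ℂ) * g.eval (y : ℂ)) * ((Real.sign (y - x) : ℂ) *
      ((Real.exp (-(2 * (1 + τ))⁻¹ * x ^ 2) : ℂ) * f.eval (x : ℂ))) := by
  have h : Real.exp (-(x ^ 2 + y ^ 2) / (2 * (1 + τ))) =
      Real.exp (-(2 * (1 + τ))⁻¹ * y ^ 2) * Real.exp (-(2 * (1 + τ))⁻¹ * x ^ 2) := by
    rw [← Real.exp_add]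
    congr 1
    ring
  rw [realIntegrand, h, Complex.ofReal_mul]
  ring

theorem integrable_gaussian_mul_eval {b : ℝ} (hb : 0 < b) (f : ℂ[X]) :
    Integrable fun x : ℝ => (Real.exp (-b * x ^ 2) : ℂ) * f.eval (x : ℂ) := by
  obtain ⟨K, N, hK, h⟩ := norm_eval_le f
  refine ((integrable_one_add_abs_pow_mul_exp hb N).const_mul K).mono' ?_
    (Filter.Eventually.of_forall fun x => ?_)
  · have := f.continuous.comp Complex.continuous_ofReal
    exact (Continuous.mul (by fun_prop) this).aestronglyMeasurable
  · have := h x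
    rw [Complex.norm_real, Real.norm_eq_abs] at this
    rw [norm_mul, Complex.norm_real, Real.norm_of_nonneg (Real.exp_pos _).le, ← mul_assoc,
      mul_comm]
    exact mul_le_mul_of_nonneg_right this (Real.exp_pos _).le

theorem integrable_realIntegrand (hτ0 : 0 < τ) (f g : ℂ[X]) :
    Integrable (fun p : ℝ × ℝ => realIntegrand τ f g p.1 p.2) (volume.prod volume) := by
  have hb : 0 < (2 * (1 + τ))⁻¹ := by positivity
  have hi := (integrable_gaussian_mul_eval hb f).mul_prod (integrable_gaussian_mul_eval hb g)
  have hm : Measurable fun p : ℝ × ℝ => (Real.sign (p.2 - p.1) : ℂ) :=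
    Complex.measurable_ofReal.comp (measurable_realSign.comp (measurable_snd.sub measurable_fst))
  refine (hi.bdd_mul (c := 1) hm.aestronglyMeasurable
    (Filter.Eventually.of_forall fun p => norm_realSign_le_one _)).congr
    (Filter.Eventually.of_forall fun p => ?_)
  simp only [realIntegrand_eq]
  ring

theorem hasDerivAt_gaussian_mul_eval (f : ℂ[X]) (x : ℝ) :
    HasDerivAt (fun x : ℝ => (Real.exp (-(2 * (1 + τ))⁻¹ * x ^ 2) : ℂ) * f.eval (x : ℂ))
      ((Real.exp (-(2 * (1 + τ))⁻¹ * x ^ 2) : ℂ) * (weightedDerivative τ f).eval (x : ℂ)) x := by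
  have h := (hasDerivAt_gaussian (-(2 * (1 + τ))⁻¹) x).fun_mul (f.hasDerivAt (x : ℂ)).comp_ofReal
  refine h.congr_deriv ?_
  simp only [weightedDerivative, eval_sub, eval_mul, eval_C, eval_X]
  push_cast
  rw [mul_inv]
  ring

/-- With the `x`-integral inside, `D f` times its half weight is an exact derivative; evaluation at
`x = y` merges the two half weights into `e^{-y²/(1+τ)}`. -/
theorem skewInnerReal_weightedDerivative (hτ0 : 0 < τ) (f g : ℂ[X]) :
    skewInnerReal τ (weightedDerivative τ f) g =
      2 * ∫ x : ℝ, (Real.exp (-(1 + τ)⁻¹ * x ^ 2) : ℂ) * (f.eval (x : ℂ) * g.eval (x : ℂ)) := by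
  have hb : 0 < (2 * (1 + τ))⁻¹ := by positivity
  rw [skewInnerReal, integral_integral_swap (integrable_realIntegrand hτ0 _ g),
    ← integral_const_mul]
  congr 1
  funext y
  simp only [realIntegrand_eq]
  rw [integral_const_mul, integral_sign_mul_of_hasDerivAt (hasDerivAt_gaussian_mul_eval f)
    (integrable_gaussian_mul_eval hb _) (integrable_gaussian_mul_eval hb _)]
  have h : Real.exp (-(1 + τ)⁻¹ * y ^ 2) =
      Real.exp (-(2 * (1 + τ))⁻¹ * y ^ 2) * Real.exp (-(2 * (1 + τ))⁻¹ * y ^ 2) := by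
    rw [← Real.exp_add, mul_inv]
    congr 1
    ring
  rw [h, Complex.ofReal_mul]
  ring

theorem skewInner_weightedDerivative (hτ0 : 0 < τ) (hτ1 : τ < 1) (f g : ℂ[X]) :
    skewInner τ (weightedDerivative τ f) g = erfcSlope τ * ellipticPairing τ f g := by
  rw [skewInner, skewInnerReal_weightedDerivative hτ0,
    skewInnerComplex_weightedDerivative hτ0 hτ1]
  ring

/-! ### Antisymmetry, parity and the norms -/

theorem skewInner_antisymm (hτ0 : 0 < τ) (hτ1 : τ < 1) (f g : ℂ[X]) :
    skewInner τ f g = -skewInner τ g f := by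
  have h : skewInnerReal τ f g = -skewInnerReal τ g f := by
    rw [skewInnerReal, skewInnerReal, integral_integral_swap (integrable_realIntegrand hτ0 f g)]
    simp only [← integral_neg]
    congr 1
    funext x
    congr 1
    funext y
    rw [realIntegrand, realIntegrand, ← neg_sub y x, Real.sign_neg, add_comm (y ^ 2)]
    push_cast
    ring
  rw [skewInner, skewInner, h, skewInnerComplex_eq hτ0 hτ1, skewInnerComplex_eq hτ0 hτ1]
  ring

/-- In the real part `(x, y) ↦ (-x, -y)` flips the sign function. In the complex part only `x` is
reflected, to stay in the half plane: `-z` is the conjugate of the reflected point, so the two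
products trade places. -/
theorem skewInner_comp_neg_X (f g : ℂ[X]) :
    skewInner τ (f.comp (-X)) (g.comp (-X)) = -skewInner τ f g := by
  have hr : skewInnerReal τ (f.comp (-X)) (g.comp (-X)) = -skewInnerReal τ f g := by
    have h : ∀ x y, realIntegrand τ (f.comp (-X)) (g.comp (-X)) x y =
        -realIntegrand τ f g (-x) (-y) := fun x y => by
      simp only [realIntegrand, eval_comp, eval_neg, eval_X, neg_sq, Complex.ofReal_neg]
      rw [show -y - -x = -(y - x) by ring, Real.sign_neg]
      push_cast
      ring
    simp only [skewInnerReal, h, integral_neg]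
    rw [integral_neg_eq_self (fun x => ∫ y, realIntegrand τ f g x (-y))]
    congr 2
    funext x
    exact integral_neg_eq_self (realIntegrand τ f g x) volume
  have hc : skewInnerComplex τ (f.comp (-X)) (g.comp (-X)) = -skewInnerComplex τ f g := by
    have h : ∀ x y, complexIntegrand τ (f.comp (-X)) (g.comp (-X)) x y =
        -complexIntegrand τ f g (-x) y := fun x y => by
      simp only [complexIntegrand, eval_comp, eval_neg, eval_X, neg_sq, Complex.ofReal_neg]
      rw [show -((x : ℂ) + Complex.I * y) = -x - Complex.I * y by ring,
        show -((x : ℂ) - Complex.I * y) = -x + Complex.I * y by ring]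
      ring
    simp only [skewInnerComplex, h, integral_neg]
    rw [integral_neg_eq_self (fun x => ∫ y in Ioi (0 : ℝ), complexIntegrand τ f g x y)]
    ring
  rw [skewInner, skewInner, hr, hc]
  ring

theorem skewInner_eq_zero_of_parity {f g : ℂ[X]} {ε : ℕ} (hf : f.comp (-X) = (-1) ^ ε * f)
    (hg : g.comp (-X) = (-1) ^ ε * g) : skewInner τ f g = 0 := by
  have h := skewInner_comp_neg_X (τ := τ) f g
  have hn : skewInner τ (-f) (-g) = skewInner τ f g := by
    simp [skewInner, skewInnerReal, skewInnerComplex, realIntegrand, complexIntegrand]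
  rw [hf, hg] at h
  rcases neg_one_pow_eq_or ℂ[X] ε with e | e
  · rw [e, one_mul, one_mul] at h
    linear_combination h / 2
  · rw [e, neg_one_mul, neg_one_mul, hn] at h
    linear_combination h / 2

/-- Here `π √(1-τ²)` is the total Gaussian mass; the factors `√(1-τ²)` cancel, so `τ` enters the
norms only through `1 + τ`. -/
theorem erfcSlope_mul (hτ0 : 0 < τ) (hτ1 : τ < 1) :
    erfcSlope τ * (Real.pi * Real.sqrt (1 - τ ^ 2)) = 2 * Real.sqrt (2 * Real.pi) := by
  have h1 : 0 < 1 - τ ^ 2 := by nlinarith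
  have h2 : Real.sqrt (1 - τ ^ 2) ≠ 0 := by positivity
  have h3 : Real.sqrt Real.pi ≠ 0 := by positivity
  have h4 : Real.sqrt Real.pi ^ 2 = Real.pi := Real.sq_sqrt Real.pi_pos.le
  rw [erfcSlope, Real.sqrt_div (by norm_num), Real.sqrt_mul (by norm_num)]
  field_simp
  exact h4.symm

theorem skewInner_skewPoly_even_odd (hτ0 : 0 < τ) (hτ1 : τ < 1) (j k : ℕ) :
    skewInner τ (skewPoly τ (2 * j)) (skewPoly τ (2 * k + 1)) = if j = k then
      (((2 * k).factorial : ℝ) * (2 * Real.sqrt (2 * Real.pi)) * (1 + τ) : ℝ) else 0 := by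
  rw [skewInner_antisymm hτ0 hτ1, skewPoly_odd_eq_weightedDerivative hτ0,
    skewInner_weightedDerivative hτ0 hτ1, ellipticPairing_C_mul_left, skewPoly_even,
    ellipticPairing_scaledHermite hτ0 hτ1]
  by_cases h : j = k
  · rw [if_pos h, if_pos (by rw [h]), ← erfcSlope_mul hτ0 hτ1]
    push_cast
    ring
  · rw [if_neg h, if_neg (by omega)]
    simp

end

theorem theorem1 (τ : ℝ) (hτ0 : 0 < τ) (hτ1 : τ < 1) :
    -- the integrals that define the skew inner product converge absolutely
    (∀ f g : ℂ[X],
      MeasureTheory.Integrable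
        (fun p : ℝ × ℝ => realIntegrand τ f g p.1 p.2) MeasureTheory.volume ∧
      MeasureTheory.IntegrableOn
        (fun p : ℝ × ℝ => complexIntegrand τ f g p.1 p.2)
        (Set.univ ×ˢ Set.Ioi (0 : ℝ)) MeasureTheory.volume) ∧
    (∀ n : ℕ, (scaledHermite τ n).Monic ∧ (scaledHermite τ n).natDegree = n) ∧
    (∀ j : ℕ, (skewPoly τ j).Monic ∧ (skewPoly τ j).natDegree = j) ∧
    IsSkewOrthogonal (skewInner τ) (skewPoly τ) ∧
    (∀ n : ℕ, skewInner τ (skewPoly τ (2 * n)) (skewPoly τ (2 * n + 1)) =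
      (((2 * n).factorial : ℝ) * (2 * Real.sqrt (2 * Real.pi)) * (1 + τ) : ℝ)) := by
  have hr : ∀ n : ℕ, skewInner τ (skewPoly τ (2 * n)) (skewPoly τ (2 * n + 1)) =
      (((2 * n).factorial : ℝ) * (2 * Real.sqrt (2 * Real.pi)) * (1 + τ) : ℝ) := fun n => by
    rw [skewInner_skewPoly_even_odd hτ0 hτ1, if_pos rfl]
  refine ⟨fun f g => ⟨integrable_realIntegrand hτ0 f g, ?_⟩, scaledHermite_monic_natDegree hτ0,
    skewPoly_monic_natDegree hτ0, ⟨fun j k => ?_, fun j k => ?_, fun j k h => ?_, fun j => ?_⟩, hr⟩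
  -- Restricting the planar measure to the half plane gives `upperVolume`.
  · rw [MeasureTheory.IntegrableOn, MeasureTheory.Measure.volume_eq_prod,
      ← MeasureTheory.Measure.prod_restrict, MeasureTheory.Measure.restrict_univ]
    exact integrable_complexIntegrand hτ0 hτ1 f g
  · refine skewInner_eq_zero_of_parity (ε := 0) ?_ ?_ <;> rw [skewPoly_comp_neg_X] <;> simp
  · refine skewInner_eq_zero_of_parity (ε := 1) ?_ ?_ <;> rw [skewPoly_comp_neg_X, pow_succ] <;> simp
  · rw [skewInner_skewPoly_even_odd hτ0 hτ1, if_neg h, Complex.ofReal_zero]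
  · rw [hr]
    have : (0 : ℝ) < ((2 * j).factorial : ℝ) := by exact_mod_cast (2 * j).factorial_pos
    exact Complex.ofReal_ne_zero.2 (by positivity)
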